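/- Let $F_n$ and $L_n$ denote the Fibonacci and Lucas numbers ($F_0=0$, $F_1=1$, $L_0=2$, $L_1=1$, both satisfying $X_n=X_{n-1}+X_{n-2}$ for $n\ge 2$), and let $\alpha=(1+\sqrt5)/2$. Let $r$ be a positive integer. Then $$\sum_{k=1}^\infty \frac{(-1)^{k(r-1)}\left(\frac{27}{5}\right)^k}{k\binom{3k}{k}F_r^{2k}} =\frac{1}{\sqrt[3]{\alpha^r}\,L_r}\left(2\sqrt3\left(\sqrt[3]{\alpha^{2r}}-(-1)^r\right)\arctan\left(\frac{\sqrt3}{2\sqrt[3]{\alpha^{2r}}+(-1)^r}\right)-(-1)^r\left(\sqrt[3]{\alpha^{2r}}+(-1)^r\right)\log\left(\frac{\sqrt5\,\alpha^rF_r}{\left(\sqrt[3]{\alpha^{2r}}-(-1)^r\right)^3}\right)\right),$$ and, if $r\ne1$, $$\sum_{k=1}^\infty \frac{(-1)^{kr}\,27^k}{k\binom{3k}{k}L_r^{2k}} =\frac{\sqrt5}{5\sqrt[3]{\alpha^r}\,F_r}\left(2\sqrt3\left(\sqrt[3]{\alpha^{2r}}+(-1)^r\right)\arctan\left(\frac{\sqrt3}{2\sqrt[3]{\alpha^{2r}}-(-1)^r}\right)+(-1)^r\left(\sqrt[3]{\alpha^{2r}}-(-1)^r\right)\log\left(\frac{\alpha^rL_r}{\left(\sqrt[3]{\alpha^{2r}}+(-1)^r\right)^3}\right)\right).$$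 -/

import Mathlib

/-- The Lucas numbers `L₀ = 2`, `L₁ = 1`, `Lₙ₊₂ = Lₙ₊₁ + Lₙ`. -/
def lucas : ℕ → ℕ
  | 0 => 2
  | 1 => 1
  | n + 2 => lucas (n + 1) + lucas n

/-- The real cube root of a nonnegative real number (only used at positive arguments). -/
noncomputable def cbrt (x : ℝ) : ℝ := x ^ (1 / 3 : ℝ)

/-! By the Beta integral, 1/(k·C(3k,k)) = ∫₀¹ x^(2k)(1-x)^(k-1) dx, so summing a geometric series
turns ∑ z^k/(k·C(3k,k)) into the integral over [0,1] of z·x²/(1 - z·x²(1-x)). The cubic denominator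
factors explicitly once z = 27t³/(1+t³)², and partial fractions then give logarithms and an
arctangent (`integral_cubic_eq`).

With φ the golden ratio, d = φ^(r/3) and s = (-1)^r, Binet's formulas read L_r = (d⁶+s)/d³ and F_r =
(d⁶-s)/(√5·d³). Hence t = -s·d² gives z = -(27/5)s/F_r², and t = s·d² gives z = 27s/L_r²: both
series are values of `hasSum_pow_div_choose`. -/

/-! ### Beta integrals and the series as an integral -/

open scoped Real Nat in
theorem integral_pow_mul_one_sub_pow (a b : ℕ) :
    ∫ x in (0 : ℝ)..1, x ^ a * (1 - x) ^ b = (a ! * b ! : ℝ) / (a + b + 1)! := by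
  induction b generalizing a with
  | zero =>
    have : ((a ! : ℕ) : ℝ) ≠ 0 := by positivity
    simp only [pow_zero, mul_one, integral_pow, Nat.factorial_zero, Nat.add_zero,
      Nat.factorial_succ a]
    push_cast
    field_simp
    simp
  | succ b ih =>
    have hderiv : ∀ x ∈ Set.uIcc (0 : ℝ) 1, HasDerivAt (fun x : ℝ => x ^ (a + 1) * (1 - x) ^ (b + 1))
        ((a + 1 : ℝ) * (x ^ a * (1 - x) ^ (b + 1)) - (b + 1 : ℝ) * (x ^ (a + 1) * (1 - x) ^ b)) x := by
      intro x _
      have h := (hasDerivAt_pow (a + 1) x).mul (((hasDerivAt_id x).const_sub 1).pow (b + 1))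
      refine h.congr_deriv ?_
      simp
      ring
    have hftc := intervalIntegral.integral_eq_sub_of_hasDerivAt hderiv
      (Continuous.intervalIntegrable (by fun_prop) _ _)
    rw [intervalIntegral.integral_sub (Continuous.intervalIntegrable (by fun_prop) _ _)
      (Continuous.intervalIntegrable (by fun_prop) _ _),
      intervalIntegral.integral_const_mul, intervalIntegral.integral_const_mul, ih (a + 1)] at hftc
    have h1 : (a + 1 + b + 1)! = (a + (b + 1) + 1)! := by congr 1; omega
    rw [h1, Nat.factorial_succ a] at hftc
    rw [Nat.factorial_succ b]
    have ha : (a + 1 : ℝ) ≠ 0 := by positivity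
    have hf : (((a + (b + 1) + 1)! : ℕ) : ℝ) ≠ 0 := by positivity
    apply mul_left_cancel₀ ha
    push_cast at hftc ⊢
    simp at hftc
    rw [sub_eq_zero.mp hftc]
    ring

theorem integral_pow_mul_one_sub_pow_eq_inv_choose (k : ℕ) :
    ∫ x in (0 : ℝ)..1, x ^ (2 * (k + 1)) * (1 - x) ^ k =
      1 / (((k + 1 : ℕ) : ℝ) * (Nat.choose (3 * (k + 1)) (k + 1) : ℝ)) := by
  rw [integral_pow_mul_one_sub_pow, Nat.cast_choose ℝ (by omega : k + 1 ≤ 3 * (k + 1)),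
    show 3 * (k + 1) - (k + 1) = 2 * (k + 1) by omega,
    show 2 * (k + 1) + k + 1 = 3 * (k + 1) by omega, Nat.factorial_succ k]
  have h1 : (Nat.factorial (3 * (k + 1)) : ℝ) ≠ 0 := by positivity
  have h2 : (Nat.factorial (2 * (k + 1)) : ℝ) ≠ 0 := by positivity
  have h3 : (Nat.factorial k : ℝ) ≠ 0 := by positivity
  push_cast
  field_simp

/-- The gap is (3x-2)²(3x+1)/27. The maximum 4/27 is what makes 27/4 the radius of convergence. -/
theorem sq_mul_one_sub_le {x : ℝ} (hx : 0 ≤ x) : x ^ 2 * (1 - x) ≤ 4 / 27 := by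
  nlinarith [mul_nonneg (sq_nonneg (3 * x - 2)) (by linarith : 0 ≤ 3 * x + 1)]

theorem hasSum_pow_div_choose_eq_integral {z : ℝ} (hz : |z| < 27 / 4) :
    HasSum (fun k : ℕ => z ^ (k + 1) /
        (((k + 1 : ℕ) : ℝ) * (Nat.choose (3 * (k + 1)) (k + 1) : ℝ)))
      (∫ x in (0 : ℝ)..1, z * x ^ 2 / (1 - z * (x ^ 2 * (1 - x)))) := by
  have hq0 : 0 ≤ |z| * (4 / 27) := by positivity
  have hq1 : |z| * (4 / 27) < 1 := by linarith
  have hle : ∀ x ∈ Set.uIoc (0 : ℝ) 1, |z * (x ^ 2 * (1 - x))| ≤ |z| * (4 / 27) := by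
    intro x hx
    rw [Set.uIoc_of_le zero_le_one] at hx
    have h0 : 0 ≤ x ^ 2 * (1 - x) := mul_nonneg (sq_nonneg x) (by linarith [hx.2])
    rw [abs_mul, abs_of_nonneg h0]
    exact mul_le_mul_of_nonneg_left (sq_mul_one_sub_le hx.1.le) (abs_nonneg z)
  have key := intervalIntegral.hasSum_integral_of_dominated_convergence
    (μ := MeasureTheory.volume) (a := 0) (b := 1)
    (F := fun (k : ℕ) (x : ℝ) => z * x ^ 2 * (z * (x ^ 2 * (1 - x))) ^ k)
    (f := fun x : ℝ => z * x ^ 2 / (1 - z * (x ^ 2 * (1 - x))))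
    (fun k _ => |z| * (|z| * (4 / 27)) ^ k)
    (fun k => (Continuous.aestronglyMeasurable (by fun_prop)))
    (fun k => Filter.Eventually.of_forall fun x hx => by
      have hx' := hx
      rw [Set.uIoc_of_le zero_le_one] at hx'
      rw [Real.norm_eq_abs, abs_mul, abs_pow]
      refine mul_le_mul ?_ (pow_le_pow_left₀ (abs_nonneg _) (hle x hx) k) (by positivity)
        (abs_nonneg z)
      rw [abs_mul, abs_of_nonneg (sq_nonneg x)]
      exact mul_le_of_le_one_right (abs_nonneg z) (pow_le_one₀ hx'.1.le hx'.2))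
    (Filter.Eventually.of_forall fun x _ =>
      (summable_geometric_of_lt_one hq0 hq1).mul_left _)
    (by simp)
    (Filter.Eventually.of_forall fun x hx => by
      have h1 : |z * (x ^ 2 * (1 - x))| < 1 := (hle x hx).trans_lt hq1
      simpa [div_eq_mul_inv] using (hasSum_geometric_of_abs_lt_one h1).mul_left (z * x ^ 2))
  have hterm (k : ℕ) : z ^ (k + 1) /
      (((k + 1 : ℕ) : ℝ) * (Nat.choose (3 * (k + 1)) (k + 1) : ℝ)) =
        ∫ x in (0 : ℝ)..1, z * x ^ 2 * (z * (x ^ 2 * (1 - x))) ^ k := by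
    rw [div_eq_mul_one_div (z ^ (k + 1)), ← integral_pow_mul_one_sub_pow_eq_inv_choose,
      ← intervalIntegral.integral_const_mul]
    congr 1
    ext x
    rw [mul_pow, mul_pow, ← pow_mul]
    ring
  simpa only [hterm] using key

/-! ### Evaluation of the cubic integral -/

/-- Up to sign, the arctangent of the antiderivative in `integral_cubic_eq` at x = 0. Since π/6 =
arctan(1/√3), this is the addition formula; |t| > 1 keeps the product of the arguments below 1, so
no multiple of π appears. -/
theorem arctan_sqrt_three_div_add_pi_div_six {t : ℝ} (ht : 1 < |t|) :
    Real.arctan (√3 / (2 * t - 1)) + Real.pi / 6 = Real.arctan ((t + 1) / (√3 * (t - 1))) := by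
  have hs : √3 ^ 2 = 3 := Real.sq_sqrt (by norm_num)
  have hs0 : √3 ≠ 0 := by positivity
  have h1 : t - 1 ≠ 0 := fun h => by rw [sub_eq_zero.mp h] at ht; simp at ht
  have h2 : 2 * t - 1 ≠ 0 := by
    intro h
    rw [show t = 1 / 2 by linarith] at ht
    norm_num [abs_of_pos] at ht
  have hlt : √3 / (2 * t - 1) * (√3)⁻¹ < 1 := by
    have : √3 / (2 * t - 1) * (√3)⁻¹ = 1 / (2 * t - 1) := by field_simp
    rw [this]
    rcases lt_abs.mp ht with h | h
    · rw [div_lt_one] <;> linarith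
    · exact (div_neg_of_pos_of_neg one_pos (by linarith)).trans one_pos
  rw [← Real.arctan_inv_sqrt_three, Real.arctan_add hlt]
  congr 1
  have h3 : 1 - √3 / (2 * t - 1) * (√3)⁻¹ ≠ 0 := by linarith
  rw [div_eq_div_iff h3 (mul_ne_zero hs0 h1)]
  field_simp
  linear_combination (t - 1) * hs

/-- The same arctangent at x = 1. The addition formula is used twice, for θ - π/6 and then for
adding θ, so that each product of arguments stays below 1. -/
theorem two_mul_arctan_sqrt_three_div_sub_pi_div_six {t : ℝ} (ht : 1 < |t|) :
    2 * Real.arctan (√3 / (2 * t - 1)) - Real.pi / 6 =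
      Real.arctan ((6 * t - (t + 1) ^ 2) / (√3 * (t ^ 2 - 1))) := by
  have hs : √3 ^ 2 = 3 := Real.sq_sqrt (by norm_num)
  have hs0 : √3 ≠ 0 := by positivity
  have ht2 : 1 < t ^ 2 := (one_lt_sq_iff_one_lt_abs t).mpr ht
  have h0 : t ≠ 0 := fun h => by norm_num [h] at ht
  have h2 : 2 * t - 1 ≠ 0 := by
    intro h
    rw [show t = 1 / 2 by linarith] at ht
    norm_num [abs_of_pos] at ht
  have hlt : √3 / (2 * t - 1) * -(√3)⁻¹ < 1 := by
    have : √3 / (2 * t - 1) * -(√3)⁻¹ = -1 / (2 * t - 1) := by field_simp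
    rw [this]
    rcases lt_abs.mp ht with h | h
    · exact (div_neg_of_neg_of_pos (by norm_num) (by linarith)).trans one_pos
    · rw [div_lt_one_of_neg] <;> linarith
  have hsub : Real.arctan (√3 / (2 * t - 1)) + Real.arctan (-(√3)⁻¹) =
      Real.arctan ((2 - t) / (√3 * t)) := by
    rw [Real.arctan_add hlt]
    congr 1
    have h3 : 1 - √3 / (2 * t - 1) * -(√3)⁻¹ ≠ 0 := by linarith
    rw [div_eq_div_iff h3 (mul_ne_zero hs0 h0)]
    field_simp
    linear_combination t * hs
  have hlt' : √3 / (2 * t - 1) * ((2 - t) / (√3 * t)) < 1 := by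
    have : √3 / (2 * t - 1) * ((2 - t) / (√3 * t)) = (2 - t) / ((2 * t - 1) * t) := by field_simp
    have hpos : 0 < (2 * t - 1) * t := by
      rcases lt_abs.mp ht with h | h <;> nlinarith
    rw [this, div_lt_one hpos]
    nlinarith
  have hadd := Real.arctan_add hlt'
  rw [← hsub, Real.arctan_neg, Real.arctan_inv_sqrt_three] at hadd
  rw [show 2 * Real.arctan (√3 / (2 * t - 1)) - Real.pi / 6 =
    Real.arctan (√3 / (2 * t - 1)) + (Real.arctan (√3 / (2 * t - 1)) + -(Real.pi / 6)) by ring, hadd]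
  congr 1
  have h3 : 1 - √3 / (2 * t - 1) * ((2 - t) / (√3 * t)) ≠ 0 := by linarith
  rw [div_eq_div_iff h3 (mul_ne_zero hs0 (by linarith))]
  field_simp
  linear_combination (t ^ 2 - 1) * t * hs

theorem integral_cubic_eq {t : ℝ} (ht : 1 < |t|) :
    ∫ x in (0 : ℝ)..1, 27 * t ^ 3 / (1 + t ^ 3) ^ 2 * x ^ 2 /
        (1 - 27 * t ^ 3 / (1 + t ^ 3) ^ 2 * (x ^ 2 * (1 - x))) =
      t / (t ^ 3 - 1) * (2 * √3 * (t + 1) * Real.arctan (√3 / (2 * t - 1)) +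
        (t - 1) * Real.log ((t ^ 2 - t + 1) / (t + 1) ^ 2)) := by
  have hs : √3 ^ 2 = 3 := Real.sq_sqrt (by norm_num)
  have hs0 : √3 ≠ 0 := by positivity
  have ht2 : 1 < t ^ 2 := (one_lt_sq_iff_one_lt_abs t).mpr ht
  have hm : t + 1 ≠ 0 := fun h => by nlinarith
  have hm1 : t - 1 ≠ 0 := fun h => by nlinarith
  have hD : 0 < t ^ 2 - t + 1 := by nlinarith
  have hT : 0 < t ^ 2 + t + 1 := by nlinarith
  have hm2 : 0 < (t + 1) ^ 2 := by positivity
  have ht3 : t ^ 3 - 1 ≠ 0 := by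
    rw [show t ^ 3 - 1 = (t - 1) * (t ^ 2 + t + 1) by ring]
    exact mul_ne_zero hm1 hT.ne'
  have ht3' : 1 + t ^ 3 ≠ 0 := by
    rw [show 1 + t ^ 3 = (t + 1) * (t ^ 2 - t + 1) by ring]
    exact mul_ne_zero hm hD.ne'
  -- In u = 3tx, the denominator is a multiple of (u + t²-t+1)·N, with N a quadratic without real
  -- roots.
  obtain ⟨N, hN⟩ : ∃ N : ℝ → ℝ, ∀ x, N x =
      (3 * t * x) ^ 2 - (t + 1) ^ 2 * (3 * t * x) + (t ^ 2 - t + 1) * (t + 1) ^ 2 := ⟨_, fun _ => rfl⟩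
  have hN4 : ∀ x, 4 * N x = (2 * (3 * t * x) - (t + 1) ^ 2) ^ 2 + 3 * (t ^ 2 - 1) ^ 2 := by
    intro x; rw [hN]; ring
  have hNpos : ∀ x, 0 < N x := by
    intro x
    have : 0 < (t ^ 2 - 1) ^ 2 := by have := sub_pos.mpr ht2; positivity
    nlinarith [hN4 x, sq_nonneg (2 * (3 * t * x) - (t + 1) ^ 2)]
  have hlin : ∀ x ∈ Set.uIcc (0 : ℝ) 1, 0 < 3 * t * x + (t ^ 2 - t + 1) := by
    intro x hx
    rw [Set.uIcc_of_le zero_le_one] at hx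
    -- The linear factor equals (1-x)(t²-t+1) + x(t+1)².
    nlinarith [mul_nonneg hx.1 hm2.le, mul_nonneg (sub_nonneg.mpr hx.2) hD.le, hx.1, hx.2]
  have hfac : ∀ x, 1 - 27 * t ^ 3 / (1 + t ^ 3) ^ 2 * (x ^ 2 * (1 - x)) =
      (3 * t * x + (t ^ 2 - t + 1)) * N x / (1 + t ^ 3) ^ 2 := by
    intro x
    rw [hN]
    field_simp
    ring
  -- Partial fractions of u²/((u + t²-t+1)·N) du: the first coefficient is the residue at u =
  -- -(t²-t+1). The behaviour 1/u at infinity makes it and the coefficient of u over N sum to 1.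
  have hderiv : ∀ x ∈ Set.uIcc (0 : ℝ) 1, HasDerivAt (fun x : ℝ =>
      (t ^ 2 - t + 1) / (3 * (t ^ 2 + t + 1)) * Real.log (3 * t * x + (t ^ 2 - t + 1)) +
      (1 - (t ^ 2 - t + 1) / (3 * (t ^ 2 + t + 1))) / 2 * Real.log (N x) +
      2 * t * (t + 1) / (√3 * (t ^ 3 - 1)) *
        Real.arctan ((2 * (3 * t * x) - (t + 1) ^ 2) / (√3 * (t ^ 2 - 1))))
      (27 * t ^ 3 / (1 + t ^ 3) ^ 2 * x ^ 2 /
        (1 - 27 * t ^ 3 / (1 + t ^ 3) ^ 2 * (x ^ 2 * (1 - x)))) x := by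
    intro x hx
    have hl := hlin x hx
    have d0 : HasDerivAt (fun x : ℝ => 3 * t * x) (3 * t) x := by
      simpa using (hasDerivAt_id x).const_mul (3 * t)
    have d1 := (d0.add_const (t ^ 2 - t + 1)).log hl.ne'
    have dN : HasDerivAt N ((2 * (3 * t * x) - (t + 1) ^ 2) * (3 * t)) x := by
      rw [funext hN]
      refine (((d0.pow 2).sub (d0.const_mul _)).add_const _).congr_deriv ?_
      simp; ring
    have d2 := dN.log (hNpos x).ne'
    have d3 := (((d0.const_mul 2).sub_const ((t + 1) ^ 2)).div_const (√3 * (t ^ 2 - 1))).arctan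
    have harc : 1 + ((2 * (3 * t * x) - (t + 1) ^ 2) / (√3 * (t ^ 2 - 1))) ^ 2 =
        4 * N x / (3 * (t ^ 2 - 1) ^ 2) := by
      rw [hN4, div_pow, mul_pow, hs]
      have : t ^ 2 - 1 ≠ 0 := by linarith
      field_simp
      ring
    refine (((d1.const_mul _).add (d2.const_mul _)).add (d3.const_mul _)).congr_deriv ?_
    rw [harc, hfac]
    have e1 : 2 * t * (t + 1) / (√3 * (t ^ 3 - 1)) * (1 / (4 * N x / (3 * (t ^ 2 - 1) ^ 2)) *
        (2 * (3 * t) / (√3 * (t ^ 2 - 1)))) =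
        3 * t ^ 2 * (t + 1) ^ 2 / (N x * (t ^ 2 + t + 1)) := by
      rw [show t ^ 3 - 1 = (t - 1) * (t ^ 2 + t + 1) by ring,
        show t ^ 2 - 1 = (t - 1) * (t + 1) by ring]
      have := (hNpos x).ne'
      field_simp
      rw [hs]; ring
    have e2 : 27 * t ^ 3 / (1 + t ^ 3) ^ 2 * x ^ 2 /
        ((3 * t * x + (t ^ 2 - t + 1)) * N x / (1 + t ^ 3) ^ 2) =
        27 * t ^ 3 * x ^ 2 / ((3 * t * x + (t ^ 2 - t + 1)) * N x) := by
      field_simp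
    rw [e1, e2]
    have hN' := (hNpos x).ne'
    have hl' := hl.ne'
    have hT' := hT.ne'
    rw [hN] at hN' ⊢
    generalize hTd : t ^ 2 + t + 1 = T at *
    generalize hld : 3 * t * x + (t ^ 2 - t + 1) = l at *
    generalize hNd : (3 * t * x) ^ 2 - (t + 1) ^ 2 * (3 * t * x) + (t ^ 2 - t + 1) * (t + 1) ^ 2 = M
      at *
    field_simp
    subst hTd hld hNd
    ring
  have hcont : ContinuousOn (fun x : ℝ => 27 * t ^ 3 / (1 + t ^ 3) ^ 2 * x ^ 2 /
      (1 - 27 * t ^ 3 / (1 + t ^ 3) ^ 2 * (x ^ 2 * (1 - x)))) (Set.uIcc 0 1) := by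
    refine ContinuousOn.div (by fun_prop) (by fun_prop) fun x hx => ?_
    rw [hfac]
    have := hlin x hx
    have := hNpos x
    positivity
  rw [intervalIntegral.integral_eq_sub_of_hasDerivAt hderiv hcont.intervalIntegrable]
  have hN0 : N 0 = (t ^ 2 - t + 1) * (t + 1) ^ 2 := by rw [hN]; ring
  have hN1 : N 1 = (t ^ 2 - t + 1) ^ 2 := by rw [hN]; ring
  have hl1 : 3 * t * 1 + (t ^ 2 - t + 1) = (t + 1) ^ 2 := by ring
  have ha1 : Real.arctan ((2 * (3 * t * 1) - (t + 1) ^ 2) / (√3 * (t ^ 2 - 1))) =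
      2 * Real.arctan (√3 / (2 * t - 1)) - Real.pi / 6 := by
    rw [two_mul_arctan_sqrt_three_div_sub_pi_div_six ht]
    congr 2; ring
  have ha0 : Real.arctan ((2 * (3 * t * 0) - (t + 1) ^ 2) / (√3 * (t ^ 2 - 1))) =
      -(Real.arctan (√3 / (2 * t - 1)) + Real.pi / 6) := by
    rw [arctan_sqrt_three_div_add_pi_div_six ht, ← Real.arctan_neg]
    congr 1
    rw [show t ^ 2 - 1 = (t - 1) * (t + 1) by ring]
    field_simp
    ring
  have hl0 : 3 * t * 0 + (t ^ 2 - t + 1) = t ^ 2 - t + 1 := by ring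
  rw [ha1, ha0, hN0, hN1, hl1, hl0]
  rw [Real.log_div hD.ne' hm2.ne', Real.log_mul hD.ne' hm2.ne', Real.log_pow (n := 2) (t ^ 2 - t + 1)]
  generalize Real.log (t ^ 2 - t + 1) = l1
  generalize Real.log ((t + 1) ^ 2) = l2
  generalize Real.arctan (√3 / (2 * t - 1)) = θ
  -- The π/6 terms cancel between the endpoints, leaving 3θ.
  have e1 : 2 * t * (t + 1) / (√3 * (t ^ 3 - 1)) * (2 * θ - Real.pi / 6) -
      2 * t * (t + 1) / (√3 * (t ^ 3 - 1)) * -(θ + Real.pi / 6) =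
      t / (t ^ 3 - 1) * (2 * √3 * (t + 1) * θ) := by
    field_simp
    rw [hs]; ring
  have e2 : t / (t ^ 3 - 1) * ((t - 1) * (l1 - l2)) = t / (t ^ 2 + t + 1) * (l1 - l2) := by
    rw [show t ^ 3 - 1 = (t - 1) * (t ^ 2 + t + 1) by ring]
    field_simp
  have e3 : (1 - 3 * ((t ^ 2 - t + 1) / (3 * (t ^ 2 + t + 1)))) / 2 = t / (t ^ 2 + t + 1) := by
    have hT' := hT.ne'
    generalize hTd : t ^ 2 + t + 1 = T at *
    field_simp
    subst hTd
    ring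
  rw [mul_add _ (2 * √3 * (t + 1) * θ), e2, ← e1, ← e3]
  push_cast
  ring

theorem hasSum_pow_div_choose {t z : ℝ} (ht : 1 < |t|) (hz : z = 27 * t ^ 3 / (1 + t ^ 3) ^ 2)
    (hz' : |z| < 27 / 4) :
    HasSum (fun k : ℕ => z ^ (k + 1) /
        (((k + 1 : ℕ) : ℝ) * (Nat.choose (3 * (k + 1)) (k + 1) : ℝ)))
      (t / (t ^ 3 - 1) * (2 * √3 * (t + 1) * Real.arctan (√3 / (2 * t - 1)) +
        (t - 1) * Real.log ((t ^ 2 - t + 1) / (t + 1) ^ 2))) := by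
  have h := hasSum_pow_div_choose_eq_integral hz'
  rw [hz] at h ⊢
  rwa [integral_cubic_eq ht] at h

/-! ### Binet formulas, cube roots and the two series -/

theorem lucas_eq (n : ℕ) : (lucas n : ℝ) = Real.goldenRatio ^ n + Real.goldenConj ^ n := by
  induction n using lucas.induct with
  | case1 => norm_num [lucas]
  | case2 => simp [lucas]
  | case3 n h1 h2 =>
    rw [lucas, Nat.cast_add, h1, h2, pow_add _ n 2, pow_add _ n 2, Real.goldenRatio_sq,
      Real.goldenConj_sq]
    ring

theorem goldenConj_pow_eq (r : ℕ) :
    Real.goldenConj ^ r = (-1) ^ r / Real.goldenRatio ^ r := by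
  rw [eq_div_iff (pow_ne_zero _ Real.goldenRatio_ne_zero), ← mul_pow,
    Real.goldenConj_mul_goldenRatio]

theorem cbrt_pow_three {x : ℝ} (hx : 0 ≤ x) : cbrt x ^ 3 = x := by
  rw [cbrt, ← Real.rpow_natCast, ← Real.rpow_mul hx]
  norm_num

theorem cbrt_pow {x : ℝ} (hx : 0 ≤ x) (n : ℕ) : cbrt (x ^ n) = cbrt x ^ n := by
  rw [cbrt, cbrt, ← Real.rpow_natCast, ← Real.rpow_natCast, ← Real.rpow_mul hx, ← Real.rpow_mul hx,
    mul_comm]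

theorem one_lt_cbrt {x : ℝ} (hx : 1 < x) : 1 < cbrt x :=
  Real.one_lt_rpow hx (by norm_num)

/-- Gives 27/L_r² ≤ 3 < 27/4. For r = 1 the ratio is 27 and the series diverges. -/
theorem three_le_lucas {n : ℕ} (hn : 2 ≤ n) : 3 ≤ lucas n := by
  obtain ⟨n, rfl⟩ := Nat.exists_eq_add_of_le' hn
  suffices h : 3 ≤ lucas (n + 2) ∧ 1 ≤ lucas (n + 1) from h.1
  induction n with
  | zero => simp [lucas]
  | succ n ih =>
    rw [show lucas (n + 1 + 2) = lucas (n + 2) + lucas (n + 1) from rfl]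
    exact ⟨by omega, by show 1 ≤ lucas (n + 2); omega⟩

theorem theorem4 (r : ℕ) (hr : 0 < r) :
    HasSum
      (fun k : ℕ =>
        (-1 : ℝ) ^ ((k + 1) * (r - 1)) * (27 / 5 : ℝ) ^ (k + 1) /
          (((k + 1 : ℕ) : ℝ) * (Nat.choose (3 * (k + 1)) (k + 1) : ℝ) *
            (Nat.fib r : ℝ) ^ (2 * (k + 1))))
      (1 / (cbrt (Real.goldenRatio ^ r) * (lucas r : ℝ)) *
        (2 * √3 * (cbrt (Real.goldenRatio ^ (2 * r)) - (-1) ^ r) *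
            Real.arctan (√3 / (2 * cbrt (Real.goldenRatio ^ (2 * r)) + (-1) ^ r)) -
          (-1) ^ r * (cbrt (Real.goldenRatio ^ (2 * r)) + (-1) ^ r) *
            Real.log (√5 * Real.goldenRatio ^ r * (Nat.fib r : ℝ) /
              (cbrt (Real.goldenRatio ^ (2 * r)) - (-1) ^ r) ^ 3)))
    ∧
    (r ≠ 1 →
      HasSum
        (fun k : ℕ =>
          (-1 : ℝ) ^ ((k + 1) * r) * (27 : ℝ) ^ (k + 1) /
            (((k + 1 : ℕ) : ℝ) * (Nat.choose (3 * (k + 1)) (k + 1) : ℝ) *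
              (lucas r : ℝ) ^ (2 * (k + 1))))
        (√5 / (5 * cbrt (Real.goldenRatio ^ r) * (Nat.fib r : ℝ)) *
          (2 * √3 * (cbrt (Real.goldenRatio ^ (2 * r)) + (-1) ^ r) *
              Real.arctan (√3 / (2 * cbrt (Real.goldenRatio ^ (2 * r)) - (-1) ^ r)) +
            (-1) ^ r * (cbrt (Real.goldenRatio ^ (2 * r)) - (-1) ^ r) *
              Real.log (Real.goldenRatio ^ r * (lucas r : ℝ) /
                (cbrt (Real.goldenRatio ^ (2 * r)) + (-1) ^ r) ^ 3)))) := by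
  set d := cbrt (Real.goldenRatio ^ r) with hd
  set s : ℝ := (-1) ^ r with hs
  have hφ : 1 < Real.goldenRatio ^ r := one_lt_pow₀ Real.one_lt_goldenRatio hr.ne'
  have hd1 : 1 < d := one_lt_cbrt hφ
  have hd3 : Real.goldenRatio ^ r = d ^ 3 := (cbrt_pow_three (by linarith)).symm
  have hc : cbrt (Real.goldenRatio ^ (2 * r)) = d ^ 2 := by
    rw [mul_comm, pow_mul, cbrt_pow (by linarith)]
  have hd0 : d ≠ 0 := by linarith
  have hc1 : 1 < d ^ 2 := one_lt_pow₀ hd1 two_ne_zero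
  have hd6 : 1 < d ^ 6 := one_lt_pow₀ hd1 (by norm_num)
  have hs2 : s = 1 ∨ s = -1 := neg_one_pow_eq_or ℝ r
  have hs0 : s ≠ 0 := by rcases hs2 with h | h <;> rw [h] <;> norm_num
  have h5 : √5 ^ 2 = 5 := Real.sq_sqrt (by norm_num)
  have h50 : √5 ≠ 0 := by positivity
  have hL : (lucas r : ℝ) = (d ^ 6 + s) / d ^ 3 := by
    rw [lucas_eq, goldenConj_pow_eq, hd3]
    field_simp
    ring
  have hF : (Nat.fib r : ℝ) = (d ^ 6 - s) / (√5 * d ^ 3) := by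
    rw [Real.coe_fib_eq, goldenConj_pow_eq, hd3]
    field_simp
    ring
  have hplus : d ^ 6 + s ≠ 0 := by rcases hs2 with h | h <;> rw [h] <;> linarith
  have hminus : d ^ 6 - s ≠ 0 := by rcases hs2 with h | h <;> rw [h] <;> linarith
  have hplus' : d ^ 2 + s ≠ 0 := by rcases hs2 with h | h <;> rw [h] <;> linarith
  have hminus' : d ^ 2 - s ≠ 0 := by rcases hs2 with h | h <;> rw [h] <;> linarith
  refine ⟨?_, fun hr1 => ?_⟩
  · have hsr : (-1 : ℝ) ^ (r - 1) = -s := by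
      obtain ⟨n, rfl⟩ := Nat.exists_eq_succ_of_ne_zero hr.ne'
      simp [hs, pow_succ]
    have hF1 : (1 : ℝ) ≤ (Nat.fib r : ℝ) := by exact_mod_cast Nat.fib_pos.mpr hr
    have ht : 1 < |-s * d ^ 2| := by
      rcases hs2 with h | h <;> rw [h] <;> simpa using hc1
    have hz : -s * (27 / 5) / (Nat.fib r : ℝ) ^ 2 =
        27 * (-s * d ^ 2) ^ 3 / (1 + (-s * d ^ 2) ^ 3) ^ 2 := by
      have h1 : 1 + (-s * d ^ 2) ^ 3 = -s * (d ^ 6 - s) := by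
        rcases hs2 with h | h <;> rw [h] <;> ring
      rw [h1, hF]
      field_simp
      rw [h5]
    have hz' : |-s * (27 / 5) / (Nat.fib r : ℝ) ^ 2| < 27 / 4 := by
      have h1 : |-s * (27 / 5)| = 27 / 5 := by
        rcases hs2 with h | h <;> rw [h] <;> norm_num [abs_of_pos]
      rw [abs_div, h1, abs_of_pos (by positivity)]
      exact (div_le_self (by norm_num) (one_le_pow₀ hF1)).trans_lt (by norm_num)
    convert hasSum_pow_div_choose ht hz hz' using 1
    · ext k
      rw [mul_comm (k + 1), pow_mul, hsr, pow_mul (Nat.fib r : ℝ),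
        div_pow (-s * (27 / 5)), mul_pow (-s)]
      have : (Nat.fib r : ℝ) ≠ 0 := by linarith
      field_simp
    -- Here (t²-t+1)/(t+1)² = (t³+1)/(t+1)³ with t = -s·d², and the signs cancel.
    · have hlog : √5 * d ^ 3 * ((d ^ 6 - s) / (√5 * d ^ 3)) / (d ^ 2 - s) ^ 3 =
          ((-s * d ^ 2) ^ 2 - -s * d ^ 2 + 1) / (-s * d ^ 2 + 1) ^ 2 := by
        have h1 : -s * d ^ 2 + 1 = -s * (d ^ 2 - s) := by
          rcases hs2 with h | h <;> rw [h] <;> ring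
        rw [h1]
        field_simp
        rcases hs2 with h | h <;> rw [h] <;> ring
      have harg : √3 / (2 * (-s * d ^ 2) - 1) = -s * (√3 / (2 * d ^ 2 + s)) := by
        have h1 : 2 * (-s * d ^ 2) - 1 = -s * (2 * d ^ 2 + s) := by
          rcases hs2 with h | h <;> rw [h] <;> ring
        have h2 : 2 * d ^ 2 + s ≠ 0 := by rcases hs2 with h | h <;> rw [h] <;> linarith
        rw [h1]
        field_simp
        rcases hs2 with h | h <;> rw [h] <;> ring
      -- The sign comes out because arctan is odd.
      have harctan : Real.arctan (√3 / (2 * (-s * d ^ 2) - 1)) =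
          -s * Real.arctan (√3 / (2 * d ^ 2 + s)) := by
        rw [harg]
        rcases hs2 with h | h <;> rw [h] <;> simp
      have hpre : -s * d ^ 2 / ((-s * d ^ 2) ^ 3 - 1) = d ^ 2 / (d ^ 6 + s) := by
        have h1 : (-s * d ^ 2) ^ 3 - 1 = -s * (d ^ 6 + s) := by
          rcases hs2 with h | h <;> rw [h] <;> ring
        rw [h1]
        field_simp
      rw [hc, hd3, hF, hL, hlog, harctan, hpre,
        show 1 / (d * ((d ^ 6 + s) / d ^ 3)) = d ^ 2 / (d ^ 6 + s) by field_simp]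
      congr 1
      generalize Real.arctan _ = θ
      generalize Real.log _ = l
      rcases hs2 with h | h <;> rw [h] <;> ring
  · have hL3 : (3 : ℝ) ≤ (lucas r : ℝ) := by exact_mod_cast three_le_lucas (by omega : 2 ≤ r)
    have ht : 1 < |s * d ^ 2| := by
      rcases hs2 with h | h <;> rw [h] <;> simpa using hc1
    have hz : s * 27 / (lucas r : ℝ) ^ 2 =
        27 * (s * d ^ 2) ^ 3 / (1 + (s * d ^ 2) ^ 3) ^ 2 := by
      have h1 : 1 + (s * d ^ 2) ^ 3 = s * (d ^ 6 + s) := by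
        rcases hs2 with h | h <;> rw [h] <;> ring
      rw [h1, hL]
      field_simp
    have hz' : |s * 27 / (lucas r : ℝ) ^ 2| < 27 / 4 := by
      have h1 : |s * 27| = 27 := by
        rcases hs2 with h | h <;> rw [h] <;> norm_num [abs_of_pos]
      rw [abs_div, h1, abs_of_pos (by positivity), div_lt_iff₀ (by positivity)]
      nlinarith
    convert hasSum_pow_div_choose ht hz hz' using 1
    · ext k
      rw [mul_comm (k + 1), pow_mul, ← hs, pow_mul (lucas r : ℝ), div_pow (s * 27), mul_pow s]
      have : (lucas r : ℝ) ≠ 0 := by linarith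
      field_simp
    · have hlog : d ^ 3 * ((d ^ 6 + s) / d ^ 3) / (d ^ 2 + s) ^ 3 =
          ((s * d ^ 2) ^ 2 - s * d ^ 2 + 1) / (s * d ^ 2 + 1) ^ 2 := by
        have h1 : s * d ^ 2 + 1 = s * (d ^ 2 + s) := by
          rcases hs2 with h | h <;> rw [h] <;> ring
        rw [h1]
        field_simp
        rcases hs2 with h | h <;> rw [h] <;> ring
      have harg : √3 / (2 * (s * d ^ 2) - 1) = s * (√3 / (2 * d ^ 2 - s)) := by
        have h1 : 2 * (s * d ^ 2) - 1 = s * (2 * d ^ 2 - s) := by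
          rcases hs2 with h | h <;> rw [h] <;> ring
        have h2 : 2 * d ^ 2 - s ≠ 0 := by rcases hs2 with h | h <;> rw [h] <;> linarith
        rw [h1]
        field_simp
        rcases hs2 with h | h <;> rw [h] <;> ring
      have harctan : Real.arctan (√3 / (2 * (s * d ^ 2) - 1)) =
          s * Real.arctan (√3 / (2 * d ^ 2 - s)) := by
        rw [harg]
        rcases hs2 with h | h <;> rw [h] <;> simp
      have hpre : s * d ^ 2 / ((s * d ^ 2) ^ 3 - 1) = d ^ 2 / (d ^ 6 - s) := by
        have h1 : (s * d ^ 2) ^ 3 - 1 = s * (d ^ 6 - s) := by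
          rcases hs2 with h | h <;> rw [h] <;> ring
        rw [h1]
        field_simp
      have hpre' : √5 / (5 * d * ((d ^ 6 - s) / (√5 * d ^ 3))) = d ^ 2 / (d ^ 6 - s) := by
        field_simp
        rw [h5]
      rw [hc, hd3, hF, hL, hlog, harctan, hpre, hpre']
      congr 1
      generalize Real.arctan _ = θ
      generalize Real.log _ = l
      rcases hs2 with h | h <;> rw [h] <;> ring
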